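/- **Model.** Fix integers $m\ge 2$, $r\ge 2$ and a constant $c_0>0$. For $n\ge1$ consider random hypergraphs on $[n]$ whose hyperedges are non-empty subsets with at most $m$ elements, and let $n+1$ be an additional null vertex. For $i_1,\dots,i_m\in[n+1]$ put $a_{i_1\dots i_m}=1$ if deleting all copies of $n+1$ from the multiset $\{\{i_1,\dots,i_m\}\}$ leaves a hyperedge (in particular a non-empty set without repetitions), and $a_{i_1\dots i_m}=0$ otherwise; $\mathcal A=(a_{i_1\dots i_m})$. Let $\mathcal O_n$ be the set of multi-indices $i_1\le\dots\le i_m$ in $[n+1]$ for which deleting all copies of $n+1$ leaves a non-empty set without repetitions; it has $\varphi(n,m)=\sum_{k=1}^m\binom nk$ elements. Let $\mathcal E_n$ be the set of matrices $\boldsymbol\alpha\in\mathbb R^{(n+1)\times r}$ with rows $\alpha_i$ such that $\|\alpha_i\|_2\le c_0$ for $i\le n$ and $\alpha_{n+1}=(1,\dots,1)$. For $\boldsymbol\alpha\in\mathcal E_n$ let $\Theta(\boldsymbol\alpha)=\mathcal I\times_1\boldsymbol\alpha\times_2\cdots\times_m\boldsymbol\alpha$, where $\mathcal I$ is the identity tensor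 of order $m$ and dimension $r$, that is, $\theta_{i_1\dots i_m}=\sum_{j=1}^r\alpha_{i_1j}\cdots\alpha_{i_mj}$; let $\Omega=\{\Theta(\boldsymbol\alpha):\boldsymbol\alpha\in\mathcal E_n\}$. Let $s_n\in(0,1]$, let $\boldsymbol\alpha^*=\boldsymbol\alpha^*_n\in\mathcal E_n$ be the true embedding and $\Theta^*=\Theta(\boldsymbol\alpha^*)$. The entries $a_i$, $i\in\mathcal O_n$, are independent, and $a_i=1$ with probability $s_n/(1+e^{-\theta^*_i})$. **Losses.** With $$L(\theta;a)=\log\Big(1+\frac{s_n}{1-s_n+e^{-\theta}}\Big)-a\log\Big(\frac{s_n}{1-s_n+e^{-\theta}}\Big),$$ put $$e_L(\Theta,\Theta^*)=\frac1{\varphi(n,m)}\sum_{i\in\mathcal O_n}E\big(L(\theta_i;a_i)-L(\theta^*_i;a_i)\big).$$ For an integer $K=K_n\ge1$ and $\lambda_{0n},\lambda_{1n}>0$ let $J_\lambda(\boldsymbol\alpha)=\lambda_{0n}\frac1n\|\boldsymbol\alpha\|_F^2+\lambda_{1n}\min_{Z,C}\frac1n\|\boldsymbol\alpha-ZC\|_F^2$,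 where $C$ ranges over $\mathbb R^{(K+1)\times r}$ and $Z$ over the $(n+1)\times(K+1)$ membership matrices of assignments $\psi:[n]\to[K]$, extended by $\psi(n+1)=K+1$ (so $Z_{ik}=1$ if $k=\psi(i)$ and $Z_{ik}=0$ otherwise). Let $$\mathcal L_\lambda(\boldsymbol\alpha;\mathcal A)=\frac1{\varphi(n,m)}\sum_{i\in\mathcal O_n}L(\theta_i;a_i)+J_\lambda(\boldsymbol\alpha),\qquad\Theta=\Theta(\boldsymbol\alpha).$$ **Proposition 1.** Suppose that, for all large $n$, $J_\lambda(\boldsymbol\alpha^*)<\frac12\epsilon_n$, and that $n\,\varphi(n,m)^{-1}\epsilon_n^{-1}\log(\epsilon_n^{-1/2})\to0$ as $n\to\infty$. Then there is a constant $c_1>0$ such that, for all sufficiently large $n$, $$P\Big(\sup_{\boldsymbol\alpha\in\mathcal E_n:\ e_L(\Theta(\boldsymbol\alpha),\Theta^*)\ge\epsilon_n}\big(\mathcal L_\lambda(\boldsymbol\alpha^*;\mathcal A)-\mathcal L_\lambda(\boldsymbol\alpha;\mathcal A)\big)\ge0\Big)\le4\exp\big(-c_1\varphi(n,m)\epsilon_n\big),$$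 where the supremum over the empty set is $-\infty$. -/

import Mathlib

open MeasureTheory ProbabilityTheory Filter Topology

noncomputable section

namespace HEM

/-- A hypergraph on the vertex set `Fin n` whose hyperedges are non-empty subsets
with at most `m` elements. -/
structure RangeHypergraph (n m : ℕ) where
  edges : Set (Finset (Fin n))
  nonempty_of_mem : ∀ e ∈ edges, e.Nonempty
  card_le_of_mem : ∀ e ∈ edges, e.card ≤ m

/-- `m`-th order real tensors of dimension `d`. -/
abbrev Tensor (m d : ℕ) : Type := (Fin m → Fin d) → ℝ

/-- The multi-index `i` has augmented Kronecker delta `0`: after deleting the null vertex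
`Fin.last n`, the multiset of its entries is non-empty and has no repeated element. -/
def DeltaZero {n m : ℕ} (i : Fin m → Fin (n + 1)) : Prop :=
  (∃ k, i k ≠ Fin.last n) ∧ ∀ k l, i k = i l → i k ≠ Fin.last n → k = l

/-- The multi-indices with order-specified augmented Kronecker delta `0`. -/
def ordIndices (n m : ℕ) : Finset (Fin m → Fin (n + 1)) :=
  open Classical in Finset.univ.filter fun i => DeltaZero i ∧ Monotone i

/-- The number of potential hyperedges, `∑_{k=1}^m (n choose k)`. -/
def phi (n m : ℕ) : ℕ := ∑ k ∈ Finset.Icc 1 m, n.choose k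

/-- The non-null vertices that occur in a multi-index. -/
def vertexSet {n m : ℕ} (i : Fin m → Fin (n + 1)) : Finset (Fin n) :=
  Finset.univ.filter fun v => ∃ k, i k = v.castSucc

/-- The adjacency tensor of the augmented multi-hypergraph. -/
def adjacency {n m : ℕ} (H : RangeHypergraph n m) : Tensor m (n + 1) := fun i =>
  open Classical in if DeltaZero i ∧ vertexSet i ∈ H.edges then 1 else 0

/-- The identity tensor of order `m` and dimension `r`. -/
def identityTensor (m r : ℕ) : Tensor m r := fun j =>
  if ∀ k l, j k = j l then 1 else 0

/-- The multilinear product `A ×₁ M ×₂ ⋯ ×ₘ M`. -/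
def modeProd {m d q : ℕ} (A : Tensor m d) (M : Matrix (Fin q) (Fin d) ℝ) : Tensor m q :=
  fun i => ∑ j : Fin m → Fin d, A j * ∏ k, M (i k) (j k)

/-- The tensor `Θ = I ×₁ α ×₂ ⋯ ×ₘ α` of an embedding matrix `α`. -/
def embTensor (m : ℕ) {n r : ℕ} (α : Matrix (Fin (n + 1)) (Fin r) ℝ) : Tensor m (n + 1) :=
  modeProd (identityTensor m r) α

/-- Embedding matrices whose rows at the vertices have Euclidean norm at most `c₀`
and whose row at the null vertex is the all-ones vector.  The parameter space of tensors is the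
image of this set under `embTensor m`. -/
def embeddings (n r : ℕ) (c₀ : ℝ) : Set (Matrix (Fin (n + 1)) (Fin r) ℝ) :=
  {α | (∀ i : Fin n, ‖WithLp.toLp 2 (α i.castSucc)‖ ≤ c₀) ∧ ∀ j, α (Fin.last n) j = 1}

/-- The entrywise loss `L(θ; a)` with sparsity factor `s`. -/
def entryLoss (s θ a : ℝ) : ℝ :=
  Real.log (1 + s / (1 - s + Real.exp (-θ))) - a * Real.log (s / (1 - s + Real.exp (-θ)))

/-- The averaged negative log-likelihood. -/
def negLogLik {n m : ℕ} (s : ℝ) (Θ A : Tensor m (n + 1)) : ℝ :=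
  (phi n m : ℝ)⁻¹ * ∑ i ∈ ordIndices n m, entryLoss s (Θ i) (A i)

/-- The squared Frobenius norm of a matrix. -/
def frobSq {p q : ℕ} (M : Matrix (Fin p) (Fin q) ℝ) : ℝ := ∑ i, ∑ j, M i j ^ 2

/-- The size penalty `J₀(α) = ‖α‖_F² / n`. -/
def J0 {n r : ℕ} (α : Matrix (Fin (n + 1)) (Fin r) ℝ) : ℝ := (1 / (n : ℝ)) * frobSq α

/-- The membership matrix of a community assignment `ψ`, where the null vertex is put
in a class of its own, numbered last. -/
def membership {n K : ℕ} (ψ : Fin n → Fin K) : Matrix (Fin (n + 1)) (Fin (K + 1)) ℝ :=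
  fun i k => if k = Fin.lastCases (Fin.last K) (fun v => (ψ v).castSucc) i then 1 else 0

/-- The community penalty `J₁(α)`, the least value of `‖α - Z C‖_F² / n` over the membership
matrices `Z` and the center matrices `C`. -/
def J1 {n r : ℕ} (K : ℕ) (α : Matrix (Fin (n + 1)) (Fin r) ℝ) : ℝ :=
  ⨅ x : (Fin n → Fin K) × Matrix (Fin (K + 1)) (Fin r) ℝ,
    (1 / (n : ℝ)) * frobSq (α - membership x.1 * x.2)

/-- The total penalty. -/
def penalty {n r : ℕ} (K : ℕ) (l₀ l₁ : ℝ) (α : Matrix (Fin (n + 1)) (Fin r) ℝ) : ℝ :=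
  l₀ * J0 α + l₁ * J1 K α

/-- The penalized loss of an embedding matrix. -/
def penLoss {n m r : ℕ} (K : ℕ) (s l₀ l₁ : ℝ) (α : Matrix (Fin (n + 1)) (Fin r) ℝ)
    (A : Tensor m (n + 1)) : ℝ :=
  negLogLik s (embTensor m α) A + penalty K l₀ l₁ α

/-- The random hypergraph `H` follows the model with sparsity factor `s` and tensor `Θ`: its
potential hyperedges appear independently, the one indexed by `i` with probability
`s / (1 + exp (-Θ i))`. -/
structure IsModel {X : Type*} [MeasurableSpace X] {n m : ℕ} (P : Measure X)
    (H : X → RangeHypergraph n m) (s : ℝ) (Θ : Tensor m (n + 1)) : Prop where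
  measurable_entry : ∀ i, Measurable fun x => adjacency (H x) i
  indep : iIndepFun (fun (i : ordIndices n m) (x : X) => adjacency (H x) i.1) P
  prob : ∀ i ∈ ordIndices n m,
    P.real {x | adjacency (H x) i = 1} = s / (1 + Real.exp (-Θ i))

/-- The average excess risk `e_L(Θ, Θ')`, the expectation being over the random hypergraph. -/
def excess {X : Type*} [MeasurableSpace X] {n m : ℕ} (P : Measure X)
    (H : X → RangeHypergraph n m) (s : ℝ) (Θ Θ' : Tensor m (n + 1)) : ℝ :=
  (phi n m : ℝ)⁻¹ * ∑ i ∈ ordIndices n m,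
    ∫ x, (entryLoss s (Θ i) (adjacency (H x) i) - entryLoss s (Θ' i) (adjacency (H x) i)) ∂P

end HEM

end

/-!
The excess loss `D = L(θ; a) - L(θ*; a)` of an entry is a log-likelihood ratio, so
`E exp (-D) = 1`, and it is bounded by a constant `M`, uniformly in the sparsity factor, because the
losses are Lipschitz in `θ` and the tensors are bounded (`HEM.abs_entryLoss_sub_le`,
`HEM.abs_embTensor_sub_le`). These two facts bound the second moment of `D` by a multiple of its mean,
and Chernoff's bound then makes it exponentially unlikely, with an exponent proportional to the mean,
that the sum of the independent excess losses is much smaller than its mean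
(`HEM.integral_exp_neg_mul_le`, `HEM.measureReal_sum_le_le`).

If the supremum in the event is non-negative, some embedding with excess risk at least `ε` has an
empirical excess loss not much above the penalty of the true embedding, which is less than `ε / 2`,
since penalties are non-negative. Rounding the embedding to a grid of spacing proportional to `ε`
changes both the excess risk and the empirical excess loss by at most `ε / 8`, so one of the grid
points has a deviation proportional to its mean, and a union bound over the grid applies
(`HEM.measureReal_le_iSup_penLoss_sub_le`). The grid has at most `(C / ε + 1) ^ (n * r)` points. By the
assumption on `ε` and the quadratic growth of `φ(n, m)`, the logarithm of this number is
negligible against `φ(n, m) * ε` (`HEM.eventually_entropy_le`).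
-/

namespace HEM

/-! ### Bounded log-likelihood ratios -/

/-- A converse to the quadratic bound on `exp (-u) - 1 + u`. In place of a Taylor remainder, the proof
squares `1 - u / 2 ≤ exp (-u / 2)` where this is possible, and is linear for `u ≥ 2`. -/
theorem sq_le_mul_exp_neg_sub {u M : ℝ} (hM : 2 ≤ M) (hu : |u| ≤ M) :
    u ^ 2 ≤ 2 * M * (Real.exp (-u) - 1 + u) := by
  obtain ⟨h1, h2⟩ := abs_le.mp hu
  rcases le_total u 2 with h | h
  · have h3 : (1 - u / 2) ^ 2 ≤ Real.exp (-u) := by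
      have h4 : 1 - u / 2 ≤ Real.exp (-u / 2) := by
        have := Real.add_one_le_exp (-u / 2); linarith
      calc (1 - u / 2) ^ 2 ≤ Real.exp (-u / 2) ^ 2 := pow_le_pow_left₀ (by linarith) h4 2
        _ = Real.exp (-u) := by rw [← Real.exp_nat_mul]; congr 1; push_cast; ring
    have h5 : u ^ 2 / 4 ≤ Real.exp (-u) - 1 + u := by nlinarith
    have : 0 ≤ u ^ 2 / 4 := by positivity
    nlinarith
  · have h5 : u / 2 ≤ Real.exp (-u) - 1 + u := by
      have := Real.exp_pos (-u); linarith
    nlinarith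

/-- For a bounded log-likelihood ratio `D` (that is, `E exp (-D) = 1`) the second moment is at most
`2 * M` times the mean, because `E D = E (exp (-D) - 1 + D)`; so `E exp (-t * D)` is governed by the
mean alone. The value `t = 1 / (16 * M)` makes the quadratic term an eighth of the linear one. -/
theorem integral_exp_neg_mul_le {Ω : Type*} [MeasurableSpace Ω] {μ : Measure Ω}
    [IsProbabilityMeasure μ] {D : Ω → ℝ} {M : ℝ} (hM : 2 ≤ M) (hD : Measurable D)
    (hDM : ∀ x, |D x| ≤ M) (hint : ∫ x, Real.exp (-D x) ∂μ = 1) :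
    ∫ x, Real.exp (-(1 / (16 * M)) * D x) ∂μ
      ≤ Real.exp (-(7 / 8) * (1 / (16 * M)) * ∫ x, D x ∂μ) := by
  set t : ℝ := 1 / (16 * M) with ht
  have ht0 : 0 < t := by positivity
  have htM : t * M = 1 / 16 := by rw [ht]; field_simp
  have iD : Integrable D μ := Integrable.of_bound hD.aestronglyMeasurable M (ae_of_all _ hDM)
  have iE : ∀ c : ℝ, Integrable (fun x => Real.exp (c * D x)) μ := fun c =>
    Integrable.of_bound (C := Real.exp (|c| * M)) (by fun_prop) (ae_of_all _ fun x => by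
      rw [Real.norm_of_nonneg (Real.exp_pos _).le]
      apply Real.exp_le_exp.mpr
      calc c * D x ≤ |c * D x| := le_abs_self _
        _ = |c| * |D x| := abs_mul _ _
        _ ≤ |c| * M := by gcongr; exact hDM x)
  have iE1 : Integrable (fun x => Real.exp (-D x)) μ := by simpa using iE (-1)
  have key : ∀ x, Real.exp (-t * D x) ≤
      (1 - t * D x) + t / 8 * (Real.exp (-D x) - 1 + D x) := by
    intro x
    have h1 : |-t * D x| ≤ 1 := by
      rw [abs_mul, abs_neg, abs_of_pos ht0]
      nlinarith [hDM x]
    have h2 := (abs_le.mp (Real.abs_exp_sub_one_sub_id_le h1)).2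
    have h3 := sq_le_mul_exp_neg_sub hM (hDM x)
    have h4 : t ^ 2 * D x ^ 2 ≤ t ^ 2 * (2 * M * (Real.exp (-D x) - 1 + D x)) := by gcongr
    have h5 : t ^ 2 * (2 * M * (Real.exp (-D x) - 1 + D x))
        = t / 8 * (Real.exp (-D x) - 1 + D x) := by
      linear_combination (2 * t * (Real.exp (-D x) - 1 + D x)) * htM
    nlinarith
  calc ∫ x, Real.exp (-t * D x) ∂μ
      ≤ ∫ x, ((1 - t * D x) + t / 8 * (Real.exp (-D x) - 1 + D x)) ∂μ :=
        integral_mono (iE _) (((integrable_const _).sub (iD.const_mul _)).add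
          (((iE1.sub (integrable_const _)).add iD).const_mul _)) key
    _ = ∫ x, ((1 - t / 8 + -(7 / 8 * t) * D x) + t / 8 * Real.exp (-D x)) ∂μ := by
        congr 1; funext x; ring
    _ = 1 - 7 / 8 * t * ∫ x, D x ∂μ := by
        rw [integral_add (f := fun x => 1 - t / 8 + -(7 / 8 * t) * D x)
            ((integrable_const _).add (iD.const_mul _)) (iE1.const_mul _),
          integral_add (integrable_const _) (iD.const_mul _), integral_const_mul,
          integral_const_mul, hint]
        simp
        ring
    _ ≤ _ := by
        have := Real.add_one_le_exp (-(7 / 8) * t * ∫ x, D x ∂μ)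
        linarith

/-- Chernoff's bound for the lower tail of a sum of independent bounded log-likelihood ratios. -/
theorem measureReal_sum_le_le {Ω ι : Type*} [Fintype ι] [MeasurableSpace Ω] {μ : Measure Ω}
    [IsProbabilityMeasure μ] {D : ι → Ω → ℝ} {M : ℝ} (hM : 2 ≤ M) (hD : ∀ i, Measurable (D i))
    (hind : iIndepFun D μ)
    (hDM : ∀ i x, |D i x| ≤ M) (hint : ∀ i, ∫ x, Real.exp (-D i x) ∂μ = 1) (y : ℝ) :
    μ.real {x | ∑ i, D i x ≤ y}
      ≤ Real.exp (1 / (16 * M) * (y - 7 / 8 * ∑ i, ∫ x, D i x ∂μ)) := by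
  set t : ℝ := 1 / (16 * M) with ht
  have ht0 : 0 < t := by positivity
  have hsum : Measurable (∑ i, D i) := by fun_prop
  have hI : Integrable (fun x => Real.exp (-t * (∑ i, D i) x)) μ :=
    Integrable.of_bound (C := Real.exp (t * (Fintype.card ι * M)))
      (by fun_prop) (ae_of_all _ fun x => by
      rw [Real.norm_of_nonneg (Real.exp_pos _).le]
      apply Real.exp_le_exp.mpr
      have h : -(∑ i, D i) x ≤ Fintype.card ι * M := by
        rw [Finset.sum_apply, ← Finset.sum_neg_distrib]
        calc ∑ i, -D i x ≤ ∑ _i : ι, M :=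
              Finset.sum_le_sum fun i _ => (neg_le_abs _).trans (hDM i x)
          _ = _ := by simp
      nlinarith)
  have h := measure_le_le_exp_mul_mgf (X := ∑ i, D i) (μ := μ) y (neg_nonpos.mpr ht0.le) hI
  rw [hind.mgf_sum hD] at h
  simp only [Finset.sum_apply] at h
  refine h.trans ?_
  calc Real.exp (- -t * y) * ∏ i, mgf (D i) μ (-t)
      ≤ Real.exp (- -t * y) * ∏ i, Real.exp (-(7 / 8) * t * ∫ x, D i x ∂μ) := by
        gcongr with i
        · exact fun i _ => mgf_nonneg
        · exact integral_exp_neg_mul_le hM (hD i) (hDM i) (hint i)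
    _ = _ := by
        rw [← Real.exp_sum, ← Real.exp_add, ← Finset.mul_sum]
        congr 1; ring

/-! ### The entrywise loss -/

theorem abs_log_add_exp_neg_sub_le {c : ℝ} (hc : 0 ≤ c) (x y : ℝ) :
    |Real.log (c + Real.exp (-x)) - Real.log (c + Real.exp (-y))| ≤ |x - y| := by
  have key : ∀ x y : ℝ,
      Real.log (c + Real.exp (-x)) - Real.log (c + Real.exp (-y)) ≤ |x - y| := by
    intro x y
    have hy : 0 < c + Real.exp (-y) := by positivity
    have h1 : Real.exp (-x) ≤ Real.exp |x - y| * Real.exp (-y) := by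
      rw [← Real.exp_add]
      exact Real.exp_le_exp.mpr (by linarith [neg_le_abs (x - y)])
    have h2 : c + Real.exp (-x) ≤ Real.exp |x - y| * (c + Real.exp (-y)) := by
      have : c ≤ Real.exp |x - y| * c :=
        le_mul_of_one_le_left hc (Real.one_le_exp (abs_nonneg _))
      linarith
    have h3 := Real.log_le_log (by positivity) h2
    rw [Real.log_mul (Real.exp_ne_zero _) hy.ne', Real.log_exp] at h3
    linarith
  exact abs_sub_le_iff.mpr ⟨key x y, abs_sub_comm x y ▸ key y x⟩

section Loss
variable {s : ℝ}

/-- The loss in a form free of quotients; for `s = 1` the term `1 - s + exp (-θ)` is still positive. -/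
theorem entryLoss_eq (hs : 0 < s) (hs1 : s ≤ 1) (θ a : ℝ) :
    entryLoss s θ a = Real.log (1 + Real.exp (-θ)) - Real.log (1 - s + Real.exp (-θ))
      - a * (Real.log s - Real.log (1 - s + Real.exp (-θ))) := by
  have hq : 0 < 1 - s + Real.exp (-θ) := by have := Real.exp_pos (-θ); linarith
  have h : 1 + s / (1 - s + Real.exp (-θ))
      = (1 + Real.exp (-θ)) / (1 - s + Real.exp (-θ)) := by field_simp; ring
  rw [entryLoss, h, Real.log_div (by positivity) hq.ne', Real.log_div hs.ne' hq.ne']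

theorem exp_neg_entryLoss_one (hs : 0 < s) (hs1 : s ≤ 1) (θ : ℝ) :
    Real.exp (-entryLoss s θ 1) = s / (1 + Real.exp (-θ)) := by
  rw [entryLoss_eq hs hs1, ← Real.exp_log (show 0 < s / (1 + Real.exp (-θ)) by positivity),
    Real.log_div hs.ne' (by positivity)]
  congr 1; ring

theorem exp_neg_entryLoss_zero (hs : 0 < s) (hs1 : s ≤ 1) (θ : ℝ) :
    Real.exp (-entryLoss s θ 0) = 1 - s / (1 + Real.exp (-θ)) := by
  have hq : 0 < 1 - s + Real.exp (-θ) := by have := Real.exp_pos (-θ); linarith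
  have h : 1 - s / (1 + Real.exp (-θ)) = (1 - s + Real.exp (-θ)) / (1 + Real.exp (-θ)) := by
    field_simp; ring
  rw [entryLoss_eq hs hs1, h,
    ← Real.exp_log (show 0 < (1 - s + Real.exp (-θ)) / (1 + Real.exp (-θ)) by positivity),
    Real.log_div hq.ne' (by positivity)]
  congr 1; ring

theorem abs_entryLoss_sub_le (hs : 0 < s) (hs1 : s ≤ 1) (θ θ' : ℝ) {a : ℝ}
    (ha : a = 0 ∨ a = 1) :
    |entryLoss s θ a - entryLoss s θ' a| ≤ 2 * |θ - θ'| := by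
  have h1 := abs_le.mp (abs_log_add_exp_neg_sub_le zero_le_one θ θ')
  have h2 := abs_le.mp (abs_log_add_exp_neg_sub_le (sub_nonneg.mpr hs1) θ θ')
  have := abs_nonneg (θ - θ')
  rw [entryLoss_eq hs hs1, entryLoss_eq hs hs1, abs_le]
  rcases ha with rfl | rfl <;> constructor <;> linarith

theorem measurable_entryLoss (s θ : ℝ) : Measurable (entryLoss s θ) := by
  unfold entryLoss; fun_prop

end Loss

theorem integral_comp_of_zero_or_one {Ω : Type*} [MeasurableSpace Ω] {μ : Measure Ω}
    [IsProbabilityMeasure μ] {Y : Ω → ℝ} (hY : Measurable Y) (h01 : ∀ x, Y x = 0 ∨ Y x = 1)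
    (f : ℝ → ℝ) :
    ∫ x, f (Y x) ∂μ = (1 - μ.real {x | Y x = 1}) * f 0 + μ.real {x | Y x = 1} * f 1 := by
  have hm : MeasurableSet {x | Y x = 1} := hY (measurableSet_singleton 1)
  have h : (fun x => f (Y x))
      = fun x => f 0 + {x | Y x = 1}.indicator (fun _ => f 1 - f 0) x := by
    funext x
    by_cases hx : Y x = 1
    · simp [hx]
    · simp [(h01 x).resolve_right hx]
  rw [h, integral_add (integrable_const _) ((integrable_const _).indicator hm),
    integral_indicator_const _ hm]
  simp
  ring

theorem adjacency_zero_or_one {n m : ℕ} (H : RangeHypergraph n m) (i : Fin m → Fin (n + 1)) :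
    adjacency H i = 0 ∨ adjacency H i = 1 := by
  unfold adjacency; split_ifs <;> simp

/-- Under the parameter `θ'` the excess loss is a log-likelihood ratio: its negative exponential is the
ratio of two probability mass functions on `{0, 1}`, so has mean one. -/
theorem integral_exp_neg_entryLoss_sub {Ω : Type*} [MeasurableSpace Ω] {μ : Measure Ω}
    [IsProbabilityMeasure μ] {Y : Ω → ℝ} (hY : Measurable Y) (h01 : ∀ x, Y x = 0 ∨ Y x = 1)
    {s : ℝ} (hs : 0 < s) (hs1 : s ≤ 1) (θ θ' : ℝ)
    (hp : μ.real {x | Y x = 1} = s / (1 + Real.exp (-θ'))) :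
    ∫ x, Real.exp (-(entryLoss s θ (Y x) - entryLoss s θ' (Y x))) ∂μ = 1 := by
  have h := integral_comp_of_zero_or_one (μ := μ) hY h01
    fun a => Real.exp (-(entryLoss s θ a - entryLoss s θ' a))
  have e : ∀ a, Real.exp (-entryLoss s θ' a) * Real.exp (-(entryLoss s θ a - entryLoss s θ' a))
      = Real.exp (-entryLoss s θ a) := fun a => by rw [← Real.exp_add]; congr 1; ring
  rw [h, hp, ← exp_neg_entryLoss_zero hs hs1, ← exp_neg_entryLoss_one hs hs1, e, e,
    exp_neg_entryLoss_zero hs hs1, exp_neg_entryLoss_one hs hs1]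
  ring

/-! ### Counting multi-indices -/

/-- A sorted multi-index without repeated vertices is determined by its vertices: at the first place
where two such multi-indices differ, the smaller of the two entries could only occur earlier in the
other one, hence twice in its own. -/
theorem eq_of_vertexSet_eq {n m : ℕ} {i j : Fin m → Fin (n + 1)} (hi : DeltaZero i)
    (hj : DeltaZero j) (mi : Monotone i) (mj : Monotone j) (h : vertexSet i = vertexSet j) :
    i = j := by
  have key : ∀ {i j : Fin m → Fin (n + 1)}, DeltaZero i → Monotone j →
      vertexSet i = vertexSet j → ∀ k, (∀ l < k, i l = j l) → j k ≤ i k := by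
    intro i j hi mj h k hk
    by_contra! hlt
    have hne : i k ≠ Fin.last n := (hlt.trans_le (Fin.le_last _)).ne
    obtain ⟨v, hv⟩ := Fin.exists_castSucc_eq.mpr hne
    have hmem : v ∈ vertexSet j := h ▸ by simpa [vertexSet] using ⟨k, hv.symm⟩
    obtain ⟨l, hl⟩ : ∃ l, j l = v.castSucc := by simpa [vertexSet] using hmem
    have hlk : l < k := by
      by_contra! hkl
      exact absurd (mj hkl) (by rw [hl, hv]; exact not_le.mpr hlt)
    have := hi.2 k l (by rw [hk l hlk, hl, hv]) hne
    exact hlk.ne' this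
  funext k
  induction k using WellFoundedLT.induction with
  | ind k ih =>
    exact le_antisymm (key hj mi h.symm k fun l hl => (ih l hl).symm) (key hi mj h k ih)

/-- In fact equality holds, but only this bound is used: averaging over `ordIndices` with weight
`1 / phi` does not enlarge a uniform bound. -/
theorem card_ordIndices_le (n m : ℕ) : (ordIndices n m).card ≤ phi n m := by
  classical
  have h : (ordIndices n m).card ≤
      ((Finset.Icc 1 m).biUnion fun k => (Finset.univ : Finset (Fin n)).powersetCard k).card := by
    refine Finset.card_le_card_of_injOn vertexSet ?_ ?_
    · intro i hi
      obtain ⟨⟨⟨k, hk⟩, -⟩, -⟩ : DeltaZero i ∧ Monotone i := by simpa [ordIndices] using hi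
      obtain ⟨v, hv⟩ := Fin.exists_castSucc_eq.mpr hk
      have h1 : (vertexSet i).Nonempty := ⟨v, by simpa [vertexSet] using ⟨k, hv.symm⟩⟩
      have h2 : (vertexSet i).card ≤ m := by
        calc (vertexSet i).card = ((vertexSet i).map Fin.castSuccEmb).card := by simp
          _ ≤ (Finset.univ.image i).card := Finset.card_le_card fun w hw => by
              obtain ⟨v, hv, rfl⟩ := Finset.mem_map.mp hw
              simpa [vertexSet] using hv
          _ ≤ m := Finset.card_image_le.trans (by simp)
      simp only [Finset.coe_biUnion, Set.mem_iUnion, Finset.mem_coe, Finset.mem_powersetCard,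
        Finset.mem_Icc]
      exact ⟨_, ⟨h1.card_pos, h2⟩, Finset.subset_univ _, rfl⟩
    · intro i hi j hj hij
      have hi' : DeltaZero i ∧ Monotone i := by simpa [ordIndices] using hi
      have hj' : DeltaZero j ∧ Monotone j := by simpa [ordIndices] using hj
      exact eq_of_vertexSet_eq hi'.1 hj'.1 hi'.2 hj'.2 hij
  refine h.trans (Finset.card_biUnion_le.trans ?_)
  simp [phi]

theorem sq_div_two_le_phi {n m : ℕ} (hm : 2 ≤ m) : (n : ℝ) ^ 2 / 2 ≤ phi n m := by
  have h1 : ∑ k ∈ ({1, 2} : Finset ℕ), n.choose k ≤ phi n m :=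
    Finset.sum_le_sum_of_subset fun k hk => by
      simp only [Finset.mem_insert, Finset.mem_singleton] at hk
      rw [Finset.mem_Icc]; omega
  have h2 : (n : ℝ) + n * (n - 1) / 2 ≤ phi n m := by
    have h3 : ((∑ k ∈ ({1, 2} : Finset ℕ), n.choose k : ℕ) : ℝ) ≤ phi n m := by exact_mod_cast h1
    simpa [Nat.cast_choose_two] using h3
  nlinarith [(Nat.cast_nonneg n : (0 : ℝ) ≤ n)]

/-! ### Bounds on embeddings, their tensors and the penalty -/

theorem abs_prod_sub_prod_le {ι : Type*} (t : Finset ι) {a b : ι → ℝ} {B η : ℝ} (hB : 1 ≤ B)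
    (ha : ∀ k, |a k| ≤ B) (hb : ∀ k, |b k| ≤ B) (hab : ∀ k, |a k - b k| ≤ η) :
    |∏ k ∈ t, a k - ∏ k ∈ t, b k| ≤ t.card * B ^ t.card * η := by
  classical
  induction t using Finset.induction_on with
  | empty => simp
  | insert k t hk ih =>
    have hη : 0 ≤ η := (abs_nonneg _).trans (hab k)
    rw [Finset.prod_insert hk, Finset.prod_insert hk, Finset.card_insert_of_notMem hk]
    have hb' : |∏ k ∈ t, b k| ≤ B ^ t.card := by
      rw [Finset.abs_prod]
      exact (Finset.prod_le_prod (fun k _ => abs_nonneg _) fun k _ => hb k).trans (by simp)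
    calc |a k * ∏ k ∈ t, a k - b k * ∏ k ∈ t, b k|
        = |a k * (∏ k ∈ t, a k - ∏ k ∈ t, b k) + (a k - b k) * ∏ k ∈ t, b k| := by
          congr 1; ring
      _ ≤ |a k| * |∏ k ∈ t, a k - ∏ k ∈ t, b k| + |a k - b k| * |∏ k ∈ t, b k| := by
          rw [← abs_mul, ← abs_mul]; exact abs_add_le _ _
      _ ≤ B * (t.card * B ^ t.card * η) + η * (B * B ^ t.card) := by
          gcongr
          · exact ha k
          · exact hab k
          · exact hb'.trans (le_mul_of_one_le_left (by positivity) hB)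
      _ = _ := by push_cast; ring

/-- The tensor of an embedding is Lipschitz in the entries of the embedding. The sum over all `r ^ m`
indices of the identity tensor is bounded crudely, although only `r` terms are non-zero. -/
theorem abs_embTensor_sub_le {m n r : ℕ} {α β : Matrix (Fin (n + 1)) (Fin r) ℝ} {B η : ℝ}
    (hB : 1 ≤ B) (hα : ∀ i j, |α i j| ≤ B) (hβ : ∀ i j, |β i j| ≤ B)
    (hαβ : ∀ i j, |α i j - β i j| ≤ η) (i : Fin m → Fin (n + 1)) :
    |embTensor m α i - embTensor m β i| ≤ r ^ m * (m * B ^ m * η) := by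
  unfold embTensor modeProd
  rw [← Finset.sum_sub_distrib]
  refine (Finset.abs_sum_le_sum_abs _ _).trans ?_
  calc ∑ j : Fin m → Fin r, |identityTensor m r j * ∏ k, α (i k) (j k)
          - identityTensor m r j * ∏ k, β (i k) (j k)|
      ≤ ∑ _j : Fin m → Fin r, m * B ^ m * η := Finset.sum_le_sum fun j _ => by
        have h := abs_prod_sub_prod_le Finset.univ hB (fun k => hα (i k) (j k))
          (fun k => hβ (i k) (j k)) (fun k => hαβ (i k) (j k))
        rw [Finset.card_univ, Fintype.card_fin] at h
        rw [← mul_sub, abs_mul]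
        refine le_trans ?_ h
        refine mul_le_of_le_one_left (abs_nonneg _) ?_
        unfold identityTensor
        split_ifs <;> simp
    _ = _ := by simp

theorem abs_apply_le_of_mem_embeddings {n r : ℕ} {c₀ B : ℝ} (h1 : 1 ≤ B) (h2 : c₀ ≤ B)
    {α : Matrix (Fin (n + 1)) (Fin r) ℝ} (hα : α ∈ embeddings n r c₀) (i : Fin (n + 1))
    (j : Fin r) : |α i j| ≤ B := by
  refine Fin.lastCases ?_ (fun v => ?_) i
  · simpa [hα.2 j] using h1
  · exact ((PiLp.norm_apply_le (WithLp.toLp 2 (α v.castSucc)) j).trans (hα.1 v)).trans h2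

theorem penalty_nonneg {n r : ℕ} (K : ℕ) {l₀ l₁ : ℝ} (h₀ : 0 ≤ l₀) (h₁ : 0 ≤ l₁)
    (α : Matrix (Fin (n + 1)) (Fin r) ℝ) : 0 ≤ penalty K l₀ l₁ α := by
  have hf : ∀ {p q : ℕ} (M : Matrix (Fin p) (Fin q) ℝ), 0 ≤ frobSq M := fun M =>
    Finset.sum_nonneg fun _ _ => Finset.sum_nonneg fun _ _ => sq_nonneg _
  have hJ0 : 0 ≤ J0 α := mul_nonneg (by positivity) (hf _)
  have hJ1 : 0 ≤ J1 K α := Real.iInf_nonneg fun _ => mul_nonneg (by positivity) (hf _)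
  unfold penalty; positivity

/-! ### The grid of embeddings and its entropy -/

/-- The matrix with last row `1` whose other entries are the grid values `-B + k * η` with indices
`k = g v j`. It need not lie in `embeddings`, since its rows are bounded entrywise only. -/
noncomputable def gridPoint (B η : ℝ) {n r N : ℕ} (g : Fin n → Fin r → Fin N) :
    Matrix (Fin (n + 1)) (Fin r) ℝ :=
  fun i j => Fin.lastCases 1 (fun v => -B + (g v j : ℕ) * η) i

theorem abs_gridPoint_le {B η : ℝ} (hB : 1 ≤ B) (hη : 0 < η) {n r : ℕ}
    (g : Fin n → Fin r → Fin (⌊2 * B / η⌋₊ + 1)) (i : Fin (n + 1)) (j : Fin r) :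
    |gridPoint B η g i j| ≤ B := by
  refine Fin.lastCases ?_ (fun v => ?_) i
  · simpa [gridPoint] using hB
  · have h : ((g v j : ℕ) : ℝ) * η ≤ 2 * B := by
      rw [← le_div_iff₀ hη]
      refine le_trans ?_ (Nat.floor_le (by positivity))
      exact_mod_cast Nat.lt_succ_iff.mp (g v j).2
    have h0 : 0 ≤ ((g v j : ℕ) : ℝ) * η := by positivity
    simp only [gridPoint, Fin.lastCases_castSucc]
    exact abs_le.mpr ⟨by linarith, by linarith⟩

theorem exists_abs_sub_gridPoint_le {n r : ℕ} {c₀ B η : ℝ} (h1 : 1 ≤ B) (h2 : c₀ ≤ B)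
    (hη : 0 < η) {α : Matrix (Fin (n + 1)) (Fin r) ℝ} (hα : α ∈ embeddings n r c₀) :
    ∃ g : Fin n → Fin r → Fin (⌊2 * B / η⌋₊ + 1), ∀ i j, |α i j - gridPoint B η g i j| ≤ η := by
  have hb := fun i j => abs_le.mp (abs_apply_le_of_mem_embeddings h1 h2 hα i j)
  refine ⟨fun v j => ⟨⌊(α v.castSucc j + B) / η⌋₊, Nat.lt_succ_of_le (Nat.floor_le_floor ?_)⟩, ?_⟩
  · gcongr; linarith [(hb v.castSucc j).2]
  · intro i j
    refine Fin.lastCases ?_ (fun v => ?_) i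
    · simpa [gridPoint, hα.2 j] using hη.le
    · have h0 : 0 ≤ (α v.castSucc j + B) / η :=
        div_nonneg (by linarith [(hb v.castSucc j).1]) hη.le
      have h3 := Nat.floor_le h0
      have h4 := Nat.lt_floor_add_one ((α v.castSucc j + B) / η)
      rw [le_div_iff₀ hη] at h3
      rw [div_lt_iff₀ hη] at h4
      simp only [gridPoint, Fin.lastCases_castSucc]
      exact abs_le.mpr ⟨by linarith, by linarith⟩

/-- The logarithm of the number of grid points is negligible against `φ n * ε n`. For `ε n` bounded
away from `0` this comes from the growth of `φ`; the hypothesis `hε` is then useless, its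
logarithm being zero or negative for `ε n ≥ 1`. For small `ε n` the logarithm is at most
`4 * log (ε n ^ (-1/2))`, and `hε` applies. -/
theorem eventually_entropy_le {φ ε : ℕ → ℝ} {C c : ℝ} (hC : 0 ≤ C) (hc : 0 < c)
    (hφ : ∀ n : ℕ, (n : ℝ) ^ 2 / 2 ≤ φ n) (hε0 : ∀ᶠ n in atTop, 0 < ε n)
    (hε : Tendsto (fun n : ℕ => (n : ℝ) * (φ n)⁻¹ * (ε n)⁻¹ *
      Real.log (ε n ^ (-(1 / 2) : ℝ))) atTop (𝓝 0)) :
    ∀ᶠ n : ℕ in atTop, n * Real.log (C / ε n + 1) ≤ c * (φ n * ε n) := by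
  set e : ℝ := (C + 1)⁻¹ with he
  have he0 : 0 < e := by positivity
  obtain ⟨n₀, hn₀⟩ := exists_nat_ge (2 * Real.log (C / e + 1) / (c * e))
  have h4 : ∀ᶠ n : ℕ in atTop, (n : ℝ) * (φ n)⁻¹ * (ε n)⁻¹ *
      Real.log (ε n ^ (-(1 / 2) : ℝ)) < c / 4 := hε.eventually_lt_const (by positivity)
  filter_upwards [hε0, h4, eventually_ge_atTop n₀, eventually_gt_atTop 0] with n h0 h4 hn hn0
  have hn0' : (0 : ℝ) < n := by exact_mod_cast hn0
  have hφ0 : 0 < φ n := lt_of_lt_of_le (by positivity) (hφ n)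
  rcases le_total e (ε n) with h | h
  · have hlog : Real.log (C / ε n + 1) ≤ Real.log (C / e + 1) := by
      apply Real.log_le_log (by positivity); gcongr
    have h5 : 2 * Real.log (C / e + 1) ≤ n * (c * e) := by
      rw [← div_le_iff₀ (by positivity)]
      exact hn₀.trans (by exact_mod_cast hn)
    calc (n : ℝ) * Real.log (C / ε n + 1) ≤ n * (n * (c * e) / 2) := by gcongr; linarith
      _ = c * (n ^ 2 / 2 * e) := by ring
      _ ≤ c * (φ n * ε n) := by gcongr; exact hφ n
  · have hε1 : ε n ≤ 1 := h.trans (inv_le_one_of_one_le₀ (by linarith))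
    have h6 : C / ε n + 1 ≤ (ε n)⁻¹ * (ε n)⁻¹ := by
      have h7 : C + 1 ≤ (ε n)⁻¹ := by
        rw [le_inv_comm₀ (by positivity) h0]; exact h
      calc C / ε n + 1 ≤ C / ε n + 1 / ε n := by
            gcongr; rw [one_le_div h0]; exact hε1
        _ = (C + 1) * (ε n)⁻¹ := by rw [← add_div, div_eq_mul_inv]
        _ ≤ _ := by gcongr
    have h8 : Real.log (C / ε n + 1) ≤ 4 * Real.log (ε n ^ (-(1 / 2) : ℝ)) := by
      refine (Real.log_le_log (by positivity) h6).trans (le_of_eq ?_)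
      rw [Real.log_mul (by positivity) (by positivity), Real.log_inv, Real.log_rpow h0]
      ring
    have h9 : (n : ℝ) * Real.log (ε n ^ (-(1 / 2) : ℝ)) ≤ c / 4 * (φ n * ε n) := by
      have : (n : ℝ) * (φ n)⁻¹ * (ε n)⁻¹ * Real.log (ε n ^ (-(1 / 2) : ℝ))
          = (n * Real.log (ε n ^ (-(1 / 2) : ℝ))) / (φ n * ε n) := by field_simp
      rw [this, div_lt_iff₀ (by positivity)] at h4
      exact h4.le
    nlinarith

/-! ### Deviations of the empirical excess loss -/

section Deviation
variable {X : Type*} [MeasurableSpace X] {n m r : ℕ} {P : Measure X} {H : X → RangeHypergraph n m}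
  {s c₀ B : ℝ} {α' β : Matrix (Fin (n + 1)) (Fin r) ℝ}

theorem measureReal_sum_entryLoss_sub_le [IsProbabilityMeasure P] {Θ Θ' : Tensor m (n + 1)}
    {M : ℝ} (hs : 0 < s) (hs1 : s ≤ 1) (hH : IsModel P H s Θ') (hM : 2 ≤ M)
    (hΘ : ∀ i, 2 * |Θ i - Θ' i| ≤ M) (y : ℝ) :
    P.real {x | ∑ i ∈ ordIndices n m, (entryLoss s (Θ i) (adjacency (H x) i)
        - entryLoss s (Θ' i) (adjacency (H x) i)) ≤ y}
      ≤ Real.exp (1 / (16 * M) * (y - 7 / 8 * (phi n m * excess P H s Θ Θ'))) := by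
  have hD : ∀ i : ordIndices n m, Measurable fun a =>
      entryLoss s (Θ i) a - entryLoss s (Θ' i) a := fun i =>
    (measurable_entryLoss _ _).sub (measurable_entryLoss _ _)
  have h01 := fun x i => adjacency_zero_or_one (H x) i
  have h := measureReal_sum_le_le (μ := P) hM
    (D := fun (i : ordIndices n m) x => entryLoss s (Θ i) (adjacency (H x) i)
      - entryLoss s (Θ' i) (adjacency (H x) i))
    (fun i => (hD i).comp (hH.measurable_entry i))
    (hH.indep.comp _ hD)
    (fun i x => (abs_entryLoss_sub_le hs hs1 _ _ (h01 x i)).trans (hΘ i))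
    (fun i => integral_exp_neg_entryLoss_sub (hH.measurable_entry i) (fun x => h01 x i) hs hs1 _ _
      (hH.prob i i.2)) y
  have e : (phi n m : ℝ) * excess P H s Θ Θ' = ∑ i ∈ ordIndices n m,
      ∫ x, (entryLoss s (Θ i) (adjacency (H x) i) - entryLoss s (Θ' i) (adjacency (H x) i)) ∂P := by
    unfold excess
    rcases eq_or_ne (phi n m) 0 with h0 | h0
    · have := card_ordIndices_le n m
      rw [h0, Nat.le_zero, Finset.card_eq_zero] at this
      simp [this]
    · exact mul_inv_cancel_left₀ (by exact_mod_cast h0) _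
  rw [e, ← Finset.sum_coe_sort]
  simp_rw [← Finset.sum_coe_sort (ordIndices n m)]
  exact h

theorem integrable_entryLoss_adjacency [IsFiniteMeasure P] {Θ : Tensor m (n + 1)}
    (hH : IsModel P H s Θ) (θ : ℝ) (i : Fin m → Fin (n + 1)) :
    Integrable (fun x => entryLoss s θ (adjacency (H x) i)) P :=
  Integrable.of_bound (C := max |entryLoss s θ 0| |entryLoss s θ 1|)
    ((measurable_entryLoss s θ).comp (hH.measurable_entry i)).aestronglyMeasurable
    (ae_of_all _ fun x => by
      rcases adjacency_zero_or_one (H x) i with h | h <;> simp [h])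

theorem abs_sum_entryLoss_sub_le (hs : 0 < s) (hs1 : s ≤ 1) {Θ Θ' A : Tensor m (n + 1)} {δ : ℝ}
    (hδ : 0 ≤ δ) (hA : ∀ i, A i = 0 ∨ A i = 1) (hΘ : ∀ i, 2 * |Θ i - Θ' i| ≤ δ) :
    |∑ i ∈ ordIndices n m, (entryLoss s (Θ i) (A i) - entryLoss s (Θ' i) (A i))|
      ≤ phi n m * δ := by
  calc _ ≤ ∑ i ∈ ordIndices n m, |entryLoss s (Θ i) (A i) - entryLoss s (Θ' i) (A i)| :=
        Finset.abs_sum_le_sum_abs _ _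
    _ ≤ ∑ _i ∈ ordIndices n m, δ := Finset.sum_le_sum fun i _ =>
        (abs_entryLoss_sub_le hs hs1 _ _ (hA i)).trans (hΘ i)
    _ ≤ phi n m * δ := by
        rw [Finset.sum_const, nsmul_eq_mul]
        have := card_ordIndices_le n m
        gcongr

/-- The excess risk is Lipschitz in the tensor; `Θ'` cancels. -/
theorem excess_sub_le [IsProbabilityMeasure P] {Θ₁ Θ₂ Θ' : Tensor m (n + 1)} {δ : ℝ}
    (hs : 0 < s) (hs1 : s ≤ 1) (hH : IsModel P H s Θ') (hδ : 0 ≤ δ)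
    (hΘ : ∀ i, 2 * |Θ₁ i - Θ₂ i| ≤ δ) :
    excess P H s Θ₁ Θ' - excess P H s Θ₂ Θ' ≤ δ := by
  have hI := fun (Θ : Tensor m (n + 1)) i => integrable_entryLoss_adjacency hH (Θ i) i
  have hI' : ∀ (Θ Ψ : Tensor m (n + 1)) i, Integrable (fun x =>
      entryLoss s (Θ i) (adjacency (H x) i) - entryLoss s (Ψ i) (adjacency (H x) i)) P :=
    fun Θ Ψ i => (hI Θ i).sub (hI Ψ i)
  have h : excess P H s Θ₁ Θ' - excess P H s Θ₂ Θ' = (phi n m : ℝ)⁻¹ *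
      ∫ x, ∑ i ∈ ordIndices n m, (entryLoss s (Θ₁ i) (adjacency (H x) i)
        - entryLoss s (Θ₂ i) (adjacency (H x) i)) ∂P := by
    unfold excess
    rw [← mul_sub, ← Finset.sum_sub_distrib]
    congr 1
    refine Eq.trans (Finset.sum_congr rfl fun i _ => ?_)
      (integral_finsetSum _ fun i _ => hI' Θ₁ Θ₂ i).symm
    rw [← integral_sub (hI' Θ₁ Θ' i) (hI' Θ₂ Θ' i)]
    congr 1; funext x; ring
  have h2 : ∫ x, ∑ i ∈ ordIndices n m, (entryLoss s (Θ₁ i) (adjacency (H x) i)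
        - entryLoss s (Θ₂ i) (adjacency (H x) i)) ∂P ≤ phi n m * δ := by
    calc _ ≤ ∫ _x, (phi n m : ℝ) * δ ∂P :=
          integral_mono (integrable_finsetSum _ fun i _ => hI' Θ₁ Θ₂ i)
            (integrable_const _) fun x => (le_abs_self _).trans
              (abs_sum_entryLoss_sub_le hs hs1 hδ (adjacency_zero_or_one (H x)) hΘ)
      _ = _ := by simp
  rw [h]
  calc (phi n m : ℝ)⁻¹ * _ ≤ (phi n m : ℝ)⁻¹ * (phi n m * δ) := by gcongr
    _ ≤ δ := by
        rw [← mul_assoc]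
        exact mul_le_of_le_one_left hδ (inv_mul_le_one)

/-- The bound for a single `n`: the number of points of a grid of spacing `ε / (16 * Λ)`, where `Λ` is
the Lipschitz constant of `embTensor`, times the deviation probability at one grid point. -/
theorem measureReal_le_iSup_penLoss_sub_le [IsProbabilityMeasure P] {K : ℕ} {l₀ l₁ ε Λ : ℝ}
    (hm : 1 ≤ m) (hr : 1 ≤ r) (hB : 1 ≤ B) (hcB : c₀ ≤ B) (hΛ : Λ = r ^ m * (m * B ^ m))
    (hs : 0 < s) (hs1 : s ≤ 1) (hl₀ : 0 ≤ l₀) (hl₁ : 0 ≤ l₁) (hφ : 0 < phi n m)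
    (hα' : α' ∈ embeddings n r c₀) (hH : IsModel P H s (embTensor m α'))
    (hJ : penalty K l₀ l₁ α' < ε / 2) :
    P.real {x | (0 : EReal) ≤
          ⨆ α ∈ {α : Matrix (Fin (n + 1)) (Fin r) ℝ | α ∈ embeddings n r c₀ ∧
            ε ≤ excess P H s (embTensor m α) (embTensor m α')},
          ((penLoss K s l₀ l₁ α' (adjacency (H x))
            - penLoss K s l₀ l₁ α (adjacency (H x)) : ℝ) : EReal)}
      ≤ (32 * B * Λ / ε + 1) ^ (n * r) *
        Real.exp (-(5 / (4096 * (B * Λ))) * (phi n m * ε)) := by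
  have hε : 0 < ε := by linarith [penalty_nonneg K hl₀ hl₁ α']
  have hm' : (1 : ℝ) ≤ m := by exact_mod_cast hm
  have hr' : (1 : ℝ) ≤ r := by exact_mod_cast hr
  have hφ' : (0 : ℝ) < phi n m := by exact_mod_cast hφ
  have hΛ1 : 1 ≤ Λ := by
    rw [hΛ]
    exact one_le_mul_of_one_le_of_one_le (one_le_pow₀ hr')
      (one_le_mul_of_one_le_of_one_le hm' (one_le_pow₀ hB))
  have hBΛ : 1 ≤ B * Λ := one_le_mul_of_one_le_of_one_le hB hΛ1
  set η : ℝ := ε / (16 * Λ) with hη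
  have hη0 : 0 < η := by positivity
  set N : ℕ := ⌊2 * B / η⌋₊ + 1 with hN
  have hα'B := abs_apply_le_of_mem_embeddings hB hcB hα'
  have hlip : ∀ {α β : Matrix (Fin (n + 1)) (Fin r) ℝ} {ζ : ℝ}, (∀ i j, |α i j| ≤ B) →
      (∀ i j, |β i j| ≤ B) → (∀ i j, |α i j - β i j| ≤ ζ) → ∀ i,
      2 * |embTensor m α i - embTensor m β i| ≤ 2 * (Λ * ζ) := by
    intro α β ζ h1 h2 h3 i
    have := abs_embTensor_sub_le hB h1 h2 h3 i
    rw [hΛ]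
    linarith
  let S : Matrix (Fin (n + 1)) (Fin r) ℝ → X → ℝ := fun β x => ∑ i ∈ ordIndices n m,
    (entryLoss s (embTensor m β i) (adjacency (H x) i)
      - entryLoss s (embTensor m α' i) (adjacency (H x) i))
  let far : Set (Fin n → Fin r → Fin N) :=
    {g | 7 / 8 * ε ≤ excess P H s (embTensor m (gridPoint B η g)) (embTensor m α')}
  classical
  -- A supremum that is only `≥ 0` need not be attained, so some `α` with increment above `-ε / 16`
  -- is used, and the slack between `ε / 2` and `ε` absorbs this loss and that of rounding `α`.
  have hcover : {x | (0 : EReal) ≤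
          ⨆ α ∈ {α : Matrix (Fin (n + 1)) (Fin r) ℝ | α ∈ embeddings n r c₀ ∧
            ε ≤ excess P H s (embTensor m α) (embTensor m α')},
          ((penLoss K s l₀ l₁ α' (adjacency (H x))
            - penLoss K s l₀ l₁ α (adjacency (H x)) : ℝ) : EReal)}
      ⊆ ⋃ g ∈ Finset.univ.filter (· ∈ far),
          {x | S (gridPoint B η g) x ≤ 11 / 16 * (phi n m * ε)} := by
    intro x hx
    have hx' : ((-(ε / 16) : ℝ) : EReal) < _ := lt_of_lt_of_le
      (by exact_mod_cast (by linarith : -(ε / 16) < 0)) hx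
    obtain ⟨α, hα⟩ := lt_iSup_iff.mp hx'
    obtain ⟨⟨hαE, hαε⟩, hα⟩ := lt_iSup_iff.mp hα
    have hα := EReal.coe_lt_coe_iff.mp hα
    obtain ⟨g, hg⟩ := exists_abs_sub_gridPoint_le hB hcB hη0 hαE
    have hclose : ∀ i, 2 * |embTensor m α i - embTensor m (gridPoint B η g) i| ≤ ε / 8 :=
      fun i => (hlip (abs_apply_le_of_mem_embeddings hB hcB hαE) (abs_gridPoint_le hB hη0 g)
        hg i).trans (le_of_eq (by rw [hη]; field_simp; norm_num))
    have h1 := excess_sub_le hs hs1 hH (by positivity) hclose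
    have h2 := (abs_le.mp (abs_sum_entryLoss_sub_le hs hs1 (by positivity)
      (adjacency_zero_or_one (H x)) hclose)).1
    have h3 : penLoss K s l₀ l₁ α' (adjacency (H x)) - penLoss K s l₀ l₁ α (adjacency (H x))
        = -((phi n m : ℝ)⁻¹ * S α x) + penalty K l₀ l₁ α' - penalty K l₀ l₁ α := by
      simp only [penLoss, negLogLik, S, Finset.sum_sub_distrib]
      ring
    have h4 : (phi n m : ℝ)⁻¹ * S α x ≤ 9 / 16 * ε := by
      linarith [penalty_nonneg K hl₀ hl₁ α]
    rw [inv_mul_le_iff₀ hφ'] at h4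
    have h5 : S α x - S (gridPoint B η g) x = ∑ i ∈ ordIndices n m,
        (entryLoss s (embTensor m α i) (adjacency (H x) i)
          - entryLoss s (embTensor m (gridPoint B η g) i) (adjacency (H x) i)) := by
      simp only [S, Finset.sum_sub_distrib]
      ring
    simp only [Set.mem_iUnion, Finset.mem_filter, Finset.mem_univ, true_and, Set.mem_ofPred_eq]
    refine ⟨g, ?_, ?_⟩
    · change 7 / 8 * ε ≤ _
      linarith
    · linarith
  have hpoint : ∀ g ∈ Finset.univ.filter (· ∈ far),
      P.real {x | S (gridPoint B η g) x ≤ 11 / 16 * (phi n m * ε)}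
        ≤ Real.exp (-(5 / (4096 * (B * Λ))) * (phi n m * ε)) := by
    intro g hg
    have hg : 7 / 8 * ε ≤ excess P H s (embTensor m (gridPoint B η g)) (embTensor m α') := by
      simpa [far] using hg
    have hβ := abs_gridPoint_le hB hη0 g
    refine (measureReal_sum_entryLoss_sub_le (M := 4 * (B * Λ)) hs hs1 hH (by linarith)
      -- Entries bounded by `B` differ by at most `2 * B`, so the Lipschitz bound also gives `M`.
      (fun i => (hlip (ζ := 2 * B) hβ hα'B (fun i j => (abs_sub _ _).trans
        (by linarith [hβ i j, hα'B i j])) i).trans (by linarith)) _).trans ?_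
    apply Real.exp_le_exp.mpr
    have h6 : 11 / 16 * (phi n m * ε) - 7 / 8 * (phi n m *
        excess P H s (embTensor m (gridPoint B η g)) (embTensor m α'))
        ≤ -(5 / 64) * (phi n m * ε) := by
      have := mul_le_mul_of_nonneg_left hg hφ'.le
      linarith
    calc _ ≤ 1 / (16 * (4 * (B * Λ))) * (-(5 / 64) * (phi n m * ε)) := by gcongr
      _ = _ := by field_simp; norm_num
  calc _ ≤ P.real (⋃ g ∈ Finset.univ.filter (· ∈ far),
          {x | S (gridPoint B η g) x ≤ 11 / 16 * (phi n m * ε)}) :=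
        measureReal_mono hcover (measure_ne_top _ _)
    _ ≤ ∑ g ∈ Finset.univ.filter (· ∈ far),
          P.real {x | S (gridPoint B η g) x ≤ 11 / 16 * (phi n m * ε)} :=
        measureReal_biUnion_finset_le _ _
    _ ≤ (Finset.univ.filter (· ∈ far)).card •
          Real.exp (-(5 / (4096 * (B * Λ))) * (phi n m * ε)) :=
        Finset.sum_le_card_nsmul _ _ _ hpoint
    _ ≤ _ := by
        rw [nsmul_eq_mul]
        gcongr
        have hcard : (Finset.univ.filter (· ∈ far)).card ≤ N ^ (n * r) := by
          refine (Finset.card_filter_le _ _).trans (le_of_eq ?_)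
          simp [mul_comm n r, pow_mul]
        calc ((Finset.univ.filter (· ∈ far)).card : ℝ) ≤ (N : ℝ) ^ (n * r) := by
              exact_mod_cast hcard
          _ ≤ _ := by
              gcongr
              rw [hN]; push_cast
              gcongr
              refine (Nat.floor_le (by positivity)).trans (le_of_eq ?_)
              rw [hη]; field_simp; norm_num

end Deviation

end HEM

theorem proposition1
    (m r : ℕ) (hm : 2 ≤ m) (hr : 2 ≤ r) (c₀ : ℝ) (hc₀ : 0 < c₀)
    (K : ℕ → ℕ) (hK : ∀ᶠ n in atTop, 1 ≤ K n)
    (s ε l₀ l₁ : ℕ → ℝ)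
    (hs : ∀ᶠ n in atTop, 0 < s n ∧ s n ≤ 1)
    (hl : ∀ᶠ n in atTop, 0 < l₀ n ∧ 0 < l₁ n)
    -- the true embeddings
    (α' : ∀ n : ℕ, Matrix (Fin (n + 1)) (Fin r) ℝ)
    (hα' : ∀ᶠ n in atTop, α' n ∈ HEM.embeddings n r c₀)
    -- the random hypergraphs
    (X : ℕ → Type*) [∀ n, MeasurableSpace (X n)]
    (P : ∀ n, Measure (X n)) [∀ n, IsProbabilityMeasure (P n)]
    (H : ∀ n, X n → HEM.RangeHypergraph n m)
    (hH : ∀ᶠ n in atTop, HEM.IsModel (P n) (H n) (s n) (HEM.embTensor m (α' n)))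
    (hJ : ∀ᶠ n in atTop, HEM.penalty (K n) (l₀ n) (l₁ n) (α' n) < ε n / 2)
    (hε : Tendsto
      (fun n : ℕ => (n : ℝ) * (HEM.phi n m : ℝ)⁻¹ * (ε n)⁻¹ *
        Real.log (ε n ^ (-(1 / 2) : ℝ))) atTop (𝓝 0)) :
    ∃ c₁ : ℝ, 0 < c₁ ∧ ∀ᶠ n in atTop,
      (P n).real {x | (0 : EReal) ≤
          ⨆ α ∈ {α : Matrix (Fin (n + 1)) (Fin r) ℝ | α ∈ HEM.embeddings n r c₀ ∧
            ε n ≤ HEM.excess (P n) (H n) (s n) (HEM.embTensor m α) (HEM.embTensor m (α' n))},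
          ((HEM.penLoss (K n) (s n) (l₀ n) (l₁ n) (α' n) (HEM.adjacency (H n x))
            - HEM.penLoss (K n) (s n) (l₀ n) (l₁ n) α (HEM.adjacency (H n x)) : ℝ) : EReal)}
        ≤ 4 * Real.exp (-c₁ * (HEM.phi n m : ℝ) * ε n) := by
  obtain ⟨B, hB, hcB⟩ : ∃ B : ℝ, 1 ≤ B ∧ c₀ ≤ B := ⟨max 1 c₀, le_max_left _ _, le_max_right _ _⟩
  obtain ⟨Λ, hΛ⟩ : ∃ Λ : ℝ, Λ = r ^ m * (m * B ^ m) := ⟨_, rfl⟩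
  have hΛ0 : 0 < Λ := by rw [hΛ]; positivity
  have hr0 : (0 : ℝ) < r := by positivity
  obtain ⟨κ, hκ⟩ : ∃ κ : ℝ, κ = 5 / (4096 * (B * Λ)) := ⟨_, rfl⟩
  have hκ0 : 0 < κ := by rw [hκ]; positivity
  have hε0 : ∀ᶠ n in atTop, 0 < ε n := by
    filter_upwards [hJ, hl] with n h1 h2
    linarith [HEM.penalty_nonneg (K n) h2.1.le h2.2.le (α' n)]
  have hent := HEM.eventually_entropy_le (C := 32 * B * Λ) (c := κ / (2 * r)) (by positivity)
    (by positivity) (fun n => HEM.sq_div_two_le_phi hm) hε0 hε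
  -- Half of the exponent `κ` pays for the number of grid points.
  refine ⟨κ / 2, by positivity, ?_⟩
  filter_upwards [hs, hl, hα', hH, hJ, hε0, hent, eventually_gt_atTop 0]
    with n hs hl hα' hH hJ hε0 hent hn
  have hφ : (0 : ℝ) < HEM.phi n m := by
    refine lt_of_lt_of_le ?_ (HEM.sq_div_two_le_phi hm)
    positivity
  refine (HEM.measureReal_le_iSup_penLoss_sub_le (by omega) (by omega) hB hcB hΛ hs.1 hs.2
    hl.1.le hl.2.le (by exact_mod_cast hφ) hα' hH hJ).trans ?_
  rw [← hκ]
  have hpos : 0 < 32 * B * Λ / ε n + 1 := by positivity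
  rw [← Real.exp_log (pow_pos hpos (n * r)), ← Real.exp_add, Real.log_pow]
  have h1 : ((n * r : ℕ) : ℝ) * Real.log (32 * B * Λ / ε n + 1)
      ≤ κ / 2 * (HEM.phi n m * ε n) := by
    calc ((n * r : ℕ) : ℝ) * Real.log (32 * B * Λ / ε n + 1)
        = r * (n * Real.log (32 * B * Λ / ε n + 1)) := by push_cast; ring
      _ ≤ r * (κ / (2 * r) * (HEM.phi n m * ε n)) := by gcongr
      _ = _ := by field_simp
  calc _ ≤ Real.exp (-(κ / 2) * HEM.phi n m * ε n) := Real.exp_le_exp.mpr (by linarith)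
    _ ≤ _ := by linarith [Real.exp_pos (-(κ / 2) * HEM.phi n m * ε n)]
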